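/- Let $B\subset\mathbb R^{d+k}$ be a compact smooth embedded $d$-dimensional submanifold, with or without boundary, with induced metric $g_B$, and for $s>0$ let $N_sB=\{(x,\nu): x\in B,\ \nu\perp T_xB,\ |\nu|<s\}$. Let $\Phi(x,\nu)=x+\nu$ and let $r>0$ be such that $\Phi$ restricts to a diffeomorphism of $N_rB$ onto its image. For $\varepsilon\in(0,1)$ let $S_\varepsilon(x,\nu)=(x,\varepsilon\nu)$ and let $g_\varepsilon=S_\varepsilon^*\Phi^*\delta$ be the scaled pullback to $N_rB$ of the Euclidean metric $\delta$. Let $x^1,\dots,x^d$ be local coordinates on $B$ and let $e_1,\dots,e_k$ be a smooth orthonormal frame of the normal bundle over the coordinate patch, so that $(x,n)\mapsto (x,n^\alpha e_\alpha(x))$, $|n|<r$, are local coordinates on $N_rB$ with coordinate fields $\partial_i$ $(1\le i\le d)$ and $\partial_{d+\alpha}$ $(1\le\alpha\le k)$. Repeated indices are summed. Let $\partial_i^H$ be the component of $\partial_i$ that is $g_\varepsilon$-orthogonal to $\operatorname{span}\{\partial_{d+1},\dots,\partial_{d+k}\}$ (Gram--Schmidt). Write $g_B$ also for the matrix of $g_B$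 in the coordinates $x$, and $g_B^{1/2}$ for its positive square root. Let $\mathrm{II}(\partial_i,\partial_j)$ be the second fundamental form (the normal component of the Euclidean derivative $\nabla_{\partial_i}\partial_j$), let $\nabla^\perp$ be the normal connection (the normal component of the Euclidean derivative of a normal field), and let $$(H_\alpha)_{ij}=\langle e_\alpha,\mathrm{II}(\partial_i,\partial_j)\rangle,\qquad (\Gamma_\beta)_{j\alpha}=\langle\nabla^\perp_{\partial_j}e_\beta,e_\alpha\rangle .$$ Put $A=I_d-\varepsilon\, n^\alpha g_B^{-1/2}H_\alpha g_B^{-1/2}$. Then at every point $(x,n)$ of the coordinate domain the vectors $\partial_1^H,\dots,\partial_d^H,\partial_{d+1},\dots,\partial_{d+k}$ form a basis of the tangent space of $N_rB$, the matrices $g_B^{1/2}$ and $A$ are invertible, and the matrix of $g_\varepsilon$ in this basis is $$\begin{bmatrix} g_B^{1/2}A^2g_B^{1/2} & 0\\ 0&\varepsilon^2I_k\end{bmatrix}.$$ Moreover, for every $\widehat\phi\in C^\infty(N_rB)$ (in particular for $\widehat\phi\in C_0^\infty(N_rB)$), the Riemannian gradient of $\widehat\phi$ with respect to $g_\varepsilon$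 is, in components with respect to the same basis, $$\operatorname{grad}\widehat\phi=\begin{bmatrix} g_B^{-1/2}A^{-2}g_B^{-1/2}\left(\nabla_x\widehat\phi-n^\beta\Gamma_\beta\nabla_n\widehat\phi\right)\\ \varepsilon^{-2}\,\nabla_n\widehat\phi\end{bmatrix},$$ where $\nabla_x\widehat\phi=(\partial_{x^1}\widehat\phi,\dots,\partial_{x^d}\widehat\phi)^T$ and $\nabla_n\widehat\phi=(\partial_{n^1}\widehat\phi,\dots,\partial_{n^k}\widehat\phi)^T$. -/

import Mathlib

open scoped ContDiff MatrixOrder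

noncomputable section

namespace TubeMetric

/-- Euclidean space `ℝᵐ`. -/
abbrev Euc (m : ℕ) := EuclideanSpace ℝ (Fin m)

/-! ### Submanifolds of Euclidean space -/

/-- The tangent space at `p` of a subset `S` of a normed space: the span of its tangent cone.
For a smooth submanifold (also at boundary points) this is the usual tangent space. -/
def tangentSpaceOf {F : Type*} [NormedAddCommGroup F] [NormedSpace ℝ F] (S : Set F) (p : F) :
    Submodule ℝ F :=
  Submodule.span ℝ (tangentConeAt ℝ S p)

/-- `ψ : V → B` is the inverse of a smooth chart of the `d`-dimensional submanifold `B` of `ℝᵐ`: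
`V` is open in `ℝᵈ` or relatively open in a half-space `{x | 0 ≤ xʲ}`, and `ψ` is a smooth
immersion that is a homeomorphism from `V` onto a relatively open subset of `B`.
The numbers `x¹, …, xᵈ` are then local coordinates on `B` at the point `ψ x`. -/
structure IsLocalParam {d m : ℕ} (B : Set (Euc m)) (V : Set (Euc d)) (ψ : Euc d → Euc m) :
    Prop where
  domain : IsOpen V ∨ ∃ (j : Fin d) (O : Set (Euc d)), IsOpen O ∧ V = O ∩ {x | 0 ≤ x j}
  smooth : ContDiffOn ℝ ∞ ψ V
  immersion : ∀ x ∈ V, Function.Injective (fderivWithin ℝ ψ V x)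
  embedding : Topology.IsEmbedding (V.domRestrict ψ)
  image : ∃ W : Set (Euc m), IsOpen W ∧ ψ '' V = B ∩ W

/-- `B` is a smooth embedded `d`-dimensional submanifold of `ℝᵐ`, with or without boundary. -/
def IsSmoothSubmanifold (d : ℕ) {m : ℕ} (B : Set (Euc m)) : Prop :=
  ∀ y ∈ B, ∃ (V : Set (Euc d)) (ψ : Euc d → Euc m), IsLocalParam B V ψ ∧ y ∈ ψ '' V

/-! ### The normal bundle, the tube and the pullback metrics -/

/-- The bundle `N_r B` of normal vectors of length less than `r`, inside `ℝᵐ × ℝᵐ`. -/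
def normalBundle {m : ℕ} (B : Set (Euc m)) (r : ℝ) : Set (Euc m × Euc m) :=
  {p | p.1 ∈ B ∧ p.2 ∈ (tangentSpaceOf B p.1)ᗮ ∧ ‖p.2‖ < r}

/-- The map `Φ (x, ν) = x + ν`. -/
def tubeMap {m : ℕ} (p : Euc m × Euc m) : Euc m := p.1 + p.2

/-- The scaling map `S_ε (x, ν) = (x, ε ν)`. -/
def scalingMap {m : ℕ} (ε : ℝ) (p : Euc m × Euc m) : Euc m × Euc m := (p.1, ε • p.2)

/-- `Φ` restricts to a diffeomorphism of `N_r B` onto its image, the tube of radius `r`: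
it has a smooth left inverse there. -/
def IsTubularRadius {m : ℕ} (B : Set (Euc m)) (r : ℝ) : Prop :=
  0 < r ∧ ∃ Ξ : Euc m → Euc m × Euc m,
    ContDiffOn ℝ ∞ Ξ (tubeMap '' normalBundle B r) ∧
      Set.LeftInvOn Ξ tubeMap (normalBundle B r)

/-- The Euclidean metric, as a field of bilinear forms. -/
def euclideanMetric (m : ℕ) (_ u v : Euc m) : ℝ := inner ℝ u v

/-- The pullback `f^* g` of a field of bilinear forms. -/
def pullback {F G : Type*} [NormedAddCommGroup F] [NormedSpace ℝ F] [NormedAddCommGroup G]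
    [NormedSpace ℝ G] (f : F → G) (g : G → G → G → ℝ) (p u v : F) : ℝ :=
  g (f p) (fderiv ℝ f p u) (fderiv ℝ f p v)

/-- The scaled pullback metric `g_ε = S_ε^* Φ^* δ`; on `N_r B` it is evaluated at vectors tangent
to `N_r B`. -/
def scaledMetric {m : ℕ} (ε : ℝ) : (p u v : Euc m × Euc m) → ℝ :=
  pullback (scalingMap ε) (pullback tubeMap (euclideanMetric m))

/-- `w` is the Riemannian gradient at `p` of the function `φ` on `N_r B` with respect to `g_ε`:
it is tangent to `N_r B` and `g_ε(w, v) = dφ(v)` for all tangent vectors `v`. -/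
def IsGradientAt {m : ℕ} (B : Set (Euc m)) (r ε : ℝ) (φ : Euc m × Euc m → ℝ)
    (p w : Euc m × Euc m) : Prop :=
  w ∈ tangentSpaceOf (normalBundle B r) p ∧
    ∀ v ∈ tangentSpaceOf (normalBundle B r) p,
      scaledMetric ε p w v = fderivWithin ℝ φ (normalBundle B r) p v

section Coordinates

variable {d m k : ℕ}

/-- `e₁, …, e_k` is a smooth orthonormal frame of the normal bundle of `B` over the coordinate
patch `ψ(V)`, written as functions of the coordinates `x ∈ V`. (It is used with `m = d + k`, so
that it spans the normal spaces.) -/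
structure IsNormalFrame (B : Set (Euc m)) (V : Set (Euc d)) (ψ : Euc d → Euc m)
    (e : Fin k → Euc d → Euc m) : Prop where
  smooth : ∀ α, ContDiffOn ℝ ∞ (e α) V
  normal : ∀ x ∈ V, ∀ α, e α x ∈ (tangentSpaceOf B (ψ x))ᗮ
  orthonormal : ∀ x ∈ V, Orthonormal ℝ (fun α => e α x)

/-! ### Geometry of `B` in the coordinates `x` -/

/-- The partial derivative `∂_{xⁱ} f` on `V`. -/
def partialX {F : Type*} [NormedAddCommGroup F] [NormedSpace ℝ F] (V : Set (Euc d))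
    (f : Euc d → F) (i : Fin d) (x : Euc d) : F :=
  fderivWithin ℝ f V x (EuclideanSpace.single i 1)

/-- The matrix of the induced metric `g_B`. -/
def metricB (V : Set (Euc d)) (ψ : Euc d → Euc m) (x : Euc d) : Matrix (Fin d) (Fin d) ℝ :=
  Matrix.of fun i j => inner ℝ (partialX V ψ i x) (partialX V ψ j x)

/-- The positive square root of the matrix of `g_B`. -/
def metricBSqrt (V : Set (Euc d)) (ψ : Euc d → Euc m) (x : Euc d) : Matrix (Fin d) (Fin d) ℝ :=
  CFC.sqrt (metricB V ψ x)

/-- The second fundamental form: the normal component of `∇_{∂ᵢ} ∂ⱼ`, where `∇` is the Euclidean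
connection. -/
def secondFundamentalForm (B : Set (Euc m)) (V : Set (Euc d)) (ψ : Euc d → Euc m) (x : Euc d)
    (i j : Fin d) : Euc m :=
  (tangentSpaceOf B (ψ x))ᗮ.starProjection (partialX V (partialX V ψ j) i x)

/-- The matrix `H_α`, with entries `⟨e_α, II(∂ᵢ, ∂ⱼ)⟩`. -/
def shapeMatrix (B : Set (Euc m)) (V : Set (Euc d)) (ψ : Euc d → Euc m)
    (e : Fin k → Euc d → Euc m) (x : Euc d) (α : Fin k) : Matrix (Fin d) (Fin d) ℝ :=
  Matrix.of fun i j => inner ℝ (e α x) (secondFundamentalForm B V ψ x i j)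

/-- The normal connection: `∇^⊥_{∂ᵢ} s` is the normal component of `∂_{xⁱ} s`. -/
def normalConnection (B : Set (Euc m)) (V : Set (Euc d)) (ψ : Euc d → Euc m)
    (s : Euc d → Euc m) (x : Euc d) (i : Fin d) : Euc m :=
  (tangentSpaceOf B (ψ x))ᗮ.starProjection (partialX V s i x)

/-- The Christoffel symbols of the normal connection, `Γ_{iα}^β = ⟨∇^⊥_{∂ᵢ} e_α, e_β⟩`. -/
def normalChristoffel (B : Set (Euc m)) (V : Set (Euc d)) (ψ : Euc d → Euc m)
    (e : Fin k → Euc d → Euc m) (x : Euc d) (i : Fin d) (α β : Fin k) : ℝ :=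
  inner ℝ (normalConnection B V ψ (e α) x i) (e β x)

/-- The matrix `Γ_β`, with entries `(Γ_β)_{jα} = Γ_{jβ}^α = ⟨∇^⊥_{∂ⱼ} e_β, e_α⟩`. -/
def connectionMatrix (B : Set (Euc m)) (V : Set (Euc d)) (ψ : Euc d → Euc m)
    (e : Fin k → Euc d → Euc m) (x : Euc d) (β : Fin k) : Matrix (Fin d) (Fin k) ℝ :=
  Matrix.of fun j α => normalChristoffel B V ψ e x j β α

/-! ### Coordinates `(x, n)` and frames on `N_r B` -/

/-- The domain of the coordinates `(x, n)` on `N_r B`. -/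
def coordDomain (k : ℕ) (V : Set (Euc d)) (r : ℝ) : Set (Euc d × Euc k) :=
  V ×ˢ Metric.ball 0 r

/-- The point of the normal bundle with coordinates `(x, n)`, namely `(ψ x, n^α e_α(x))`. -/
def bundleParam (ψ : Euc d → Euc m) (e : Fin k → Euc d → Euc m) (q : Euc d × Euc k) :
    Euc m × Euc m :=
  (ψ q.1, ∑ α, q.2 α • e α q.1)

/-- The coordinate field `∂ᵢ`, a tangent vector of `N_r B`. -/
def coordField (V : Set (Euc d)) (r : ℝ) (ψ : Euc d → Euc m) (e : Fin k → Euc d → Euc m)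
    (q : Euc d × Euc k) (i : Fin d) : Euc m × Euc m :=
  fderivWithin ℝ (bundleParam ψ e) (coordDomain k V r) q (EuclideanSpace.single i 1, 0)

/-- The coordinate field `∂_{d+α}`, a tangent vector of the fibre. -/
def fibreField (V : Set (Euc d)) (r : ℝ) (ψ : Euc d → Euc m) (e : Fin k → Euc d → Euc m)
    (q : Euc d × Euc k) (α : Fin k) : Euc m × Euc m :=
  fderivWithin ℝ (bundleParam ψ e) (coordDomain k V r) q (0, EuclideanSpace.single α 1)

/-- The field `∂ᵢ^H`: Gram-Schmidt orthogonalization of `∂ᵢ` against the (mutually orthogonal)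
fibre fields, with respect to `g_ε`. -/
def horizontalField (V : Set (Euc d)) (r ε : ℝ) (ψ : Euc d → Euc m) (e : Fin k → Euc d → Euc m)
    (q : Euc d × Euc k) (i : Fin d) : Euc m × Euc m :=
  coordField V r ψ e q i -
    ∑ α, (scaledMetric ε (bundleParam ψ e q) (coordField V r ψ e q i) (fibreField V r ψ e q α) /
        scaledMetric ε (bundleParam ψ e q) (fibreField V r ψ e q α) (fibreField V r ψ e q α)) •
      fibreField V r ψ e q α

/-- The frame `∂₁^H, …, ∂_d^H, ∂_{d+1}, …, ∂_{d+k}`. -/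
def adaptedFrame (V : Set (Euc d)) (r ε : ℝ) (ψ : Euc d → Euc m) (e : Fin k → Euc d → Euc m)
    (q : Euc d × Euc k) : Fin d ⊕ Fin k → Euc m × Euc m :=
  Sum.elim (horizontalField V r ε ψ e q) (fibreField V r ψ e q)

/-- The matrix of `g_ε` in the adapted frame. -/
def metricMatrix (V : Set (Euc d)) (r ε : ℝ) (ψ : Euc d → Euc m) (e : Fin k → Euc d → Euc m)
    (q : Euc d × Euc k) : Matrix (Fin d ⊕ Fin k) (Fin d ⊕ Fin k) ℝ :=
  Matrix.of fun a b => scaledMetric ε (bundleParam ψ e q)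
    (adaptedFrame V r ε ψ e q a) (adaptedFrame V r ε ψ e q b)

/-- The matrix `I - ε n^α g_B^{-1/2} H_α g_B^{-1/2}`. -/
def deformationMatrix (B : Set (Euc m)) (V : Set (Euc d)) (ε : ℝ) (ψ : Euc d → Euc m)
    (e : Fin k → Euc d → Euc m) (q : Euc d × Euc k) : Matrix (Fin d) (Fin d) ℝ :=
  1 - ε • ∑ α, q.2 α • ((metricBSqrt V ψ q.1)⁻¹ * shapeMatrix B V ψ e q.1 α *
    (metricBSqrt V ψ q.1)⁻¹)

/-- The canonical gradient `∇ₓ φ` of a function on `N_r B` in the coordinates `(x, n)`. -/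
def gradX (V : Set (Euc d)) (r : ℝ) (ψ : Euc d → Euc m) (e : Fin k → Euc d → Euc m)
    (φ : Euc m × Euc m → ℝ) (q : Euc d × Euc k) (i : Fin d) : ℝ :=
  fderivWithin ℝ (φ ∘ bundleParam ψ e) (coordDomain k V r) q (EuclideanSpace.single i 1, 0)

/-- The canonical gradient `∇ₙ φ` of a function on `N_r B` in the coordinates `(x, n)`. -/
def gradN (V : Set (Euc d)) (r : ℝ) (ψ : Euc d → Euc m) (e : Fin k → Euc d → Euc m)
    (φ : Euc m × Euc m → ℝ) (q : Euc d × Euc k) (α : Fin k) : ℝ :=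
  fderivWithin ℝ (φ ∘ bundleParam ψ e) (coordDomain k V r) q (0, EuclideanSpace.single α 1)

end Coordinates

end TubeMetric

end

open TubeMetric

/-! The map `Φ ∘ S_ε` is the linear map `(x, ν) ↦ x + ε ν`, so `g_ε(u, v)` is the Euclidean inner
product of `pushMap u` and `pushMap v` (`scaledMetric_eq`). The fibre fields push forward to `ε
e_α`, which gives the block `ε² I`. The pushforward of `∂ᵢ^H` is orthogonal to every `e_α`, hence
tangent to `B` (`pushMap_horizontalField_mem`). By Weingarten its inner products with the `∂ⱼψ` form
the symmetric matrix `M = g_B - ε n^α H_α`. Vectors tangent to `B` are determined by these products,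
and `gram_of_mem_span` gives the Gram matrix `M g_B⁻¹ M`, which is `R A² R` for `R = g_B^{1/2}` and
`A = R⁻¹ M R⁻¹`.

Invertibility of `A` is the nondegeneracy of `g_ε`: the smooth left inverse of `Φ` makes `Φ` an
immersion at `(x, ε n)`, a point of the tube because `ε < 1` (`injective_pushMap_comp`). The
gradient then solves a linear system with the block matrix, whose right-hand side comes from `∂ᵢ^H =
∂ᵢ - (n^β Γ_β)_{iα} ∂_{d+α}`.

Since tangent spaces are spans of tangent cones, they are first identified with ranges of
derivatives of parametrizations (`tangentSpaceOf_eq_range`). -/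

namespace TubeMetric

open Filter Topology Asymptotics

/-! ### Tangent cones of parametrized sets. -/

section Tangent

variable {E F : Type*} [NormedAddCommGroup E] [NormedSpace ℝ E] [FiniteDimensional ℝ E]
  [NormedAddCommGroup F] [NormedSpace ℝ F]

/-- The tangent space of the image of an immersion whose inverse is continuous at the base point
is the range of the derivative. -/
theorem tangentSpaceOf_eq_range {f : E → F} {f' : E →L[ℝ] F} {D : Set E} {S W : Set F} {x : E}
    (hf : HasFDerivWithinAt f f' D x) (hinj : Function.Injective f')
    (hD : UniqueDiffWithinAt ℝ D x) (hx : x ∈ D) (hW : IsOpen W) (himg : f '' D = S ∩ W)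
    (hinv : comap f (𝓝 (f x)) ⊓ 𝓟 D ≤ 𝓝 x) :
    tangentSpaceOf S (f x) = LinearMap.range f'.toLinearMap := by
  have hfx : f x ∈ S ∩ W := himg ▸ Set.mem_image_of_mem f hx
  have hS : tangentConeAt ℝ S (f x) = tangentConeAt ℝ (f '' D) (f x) := by
    rw [himg, tangentConeAt_inter_nhds (hW.mem_nhds hfx.2)]
  unfold tangentSpaceOf
  rw [hS]
  apply le_antisymm
  · refine Submodule.span_le.2 fun y hy => ?_
    obtain ⟨α, l, hl, c, δ, hδ, hmem, hlim⟩ := exists_fun_of_mem_tangentConeAt hy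
    have hz : ∀ a, ∃ z, f x + δ a ∈ f '' D → z ∈ D ∧ f z = f x + δ a := fun a => by
      by_cases h : f x + δ a ∈ f '' D
      · obtain ⟨z, hz⟩ := h
        exact ⟨z, fun _ => hz⟩
      · exact ⟨x, fun h' => absurd h' h⟩
    choose z hz using hz
    have hzD : ∀ᶠ a in l, z a ∈ D := hmem.mono fun a ha => (hz a ha).1
    have hfz : (fun a => f (z a)) =ᶠ[l] fun a => f x + δ a := hmem.mono fun a ha => (hz a ha).2
    have hzx : Tendsto z l (𝓝 x) := by
      refine Tendsto.mono_right ?_ hinv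
      refine tendsto_inf.2 ⟨tendsto_comap_iff.2 ?_, tendsto_principal.2 hzD⟩
      refine Tendsto.congr' hfz.symm ?_
      simpa using tendsto_const_nhds.add hδ
    have hzx' : Tendsto z l (𝓝[D] x) := tendsto_nhdsWithin_iff.2 ⟨hzx, hzD⟩
    have ho : (fun a => δ a - f' (z a - x)) =o[l] fun a => z a - x := by
      refine (hf.isLittleO.comp_tendsto hzx').congr' ?_ EventuallyEq.rfl
      filter_upwards [hfz] with a ha
      simp [ha]
    obtain ⟨K, -, hK⟩ := f'.toLinearMap.exists_antilipschitzWith (LinearMap.ker_eq_bot.2 hinj)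
    -- An injective linear map in finite dimension is bounded below, so the remainder is negligible
    -- against `f' (z a - x)`. Thus `z a - x = O(δ)`, and `c a • f' (z a - x)` has the same limit
    -- `y` as `c a • δ a`.
    have hO : (fun a => z a - x) =O[l] fun a => f' (z a - x) := by
      refine IsBigO.of_bound K (Eventually.of_forall fun a => ?_)
      have := hK.le_mul_dist (z a - x) 0
      simpa [dist_eq_norm] using this
    have hO' : (fun a => z a - x) =O[l] δ := by
      have h1 : (fun a => f' (z a - x)) =O[l] δ := by
        have h2 := (ho.trans_isBigO hO).right_isBigO_add
        simpa using h2
      exact hO.trans h1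
    have ho' : (fun a => c a • (δ a - f' (z a - x))) =o[l] fun a => c a • δ a :=
      (isBigO_refl c l).smul_isLittleO (ho.trans_isBigO hO')
    have ho1 : Tendsto (fun a => c a • (δ a - f' (z a - x))) l (𝓝 0) :=
      (isLittleO_one_iff ℝ).1 (ho'.trans_isBigO (hlim.isBigO_one ℝ))
    have hl2 : Tendsto (fun a => f' (c a • (z a - x))) l (𝓝 y) := by
      have := hlim.sub ho1
      simpa [smul_sub] using this
    have hcl : IsClosed (LinearMap.range f'.toLinearMap : Set F) :=
      Submodule.closed_of_finiteDimensional _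
    exact hcl.mem_of_tendsto hl2 (Eventually.of_forall fun a => ⟨_, rfl⟩)
  -- Unique differentiability makes the span of the cone dense; in finite dimension a dense subspace
  -- is everything.
  · have htop : Submodule.span ℝ (tangentConeAt ℝ D x) = ⊤ := by
      have hc : IsClosed (Submodule.span ℝ (tangentConeAt ℝ D x) : Set E) :=
        Submodule.closed_of_finiteDimensional _
      have := hD.dense_tangentConeAt.closure_eq
      rw [hc.closure_eq] at this
      exact SetLike.coe_injective (by simpa using this)
    rw [LinearMap.range_eq_map, ← htop, Submodule.map_span]
    refine Submodule.span_mono ?_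
    rintro _ ⟨v, hv, rfl⟩
    exact hf.mapsTo_tangent_cone hv

end Tangent

/-! ### Linear algebra of Gram matrices. -/

section Gram

variable {ι E : Type*} [Fintype ι] [DecidableEq ι] [NormedAddCommGroup E] [InnerProductSpace ℝ E]

/-- The Gram matrix of vectors in the span of a linearly independent family, in terms of the inner
products with that family. -/
theorem gram_of_mem_span {v w : ι → E} (hv : LinearIndependent ℝ v)
    (hw : ∀ i, w i ∈ Submodule.span ℝ (Set.range v)) :
    Matrix.gram ℝ w = (Matrix.of fun i j => inner ℝ (w i) (v j)) * (Matrix.gram ℝ v)⁻¹ *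
      (Matrix.of fun i j => inner ℝ (w i) (v j)).transpose := by
  -- With `w = C v` and `G` the Gram matrix of `v`, the mixed products are `C G` and the Gram matrix
  -- of `w` is `C G Cᵀ = (C G) G⁻¹ (C G)ᵀ`.
  have hC : ∀ i, ∃ c : ι → ℝ, ∑ l, c l • v l = w i := fun i =>
    (Submodule.mem_span_range_iff_exists_fun ℝ).1 (hw i)
  choose C hC using hC
  have hu : IsUnit (Matrix.gram ℝ v).det :=
    (Matrix.isUnit_iff_isUnit_det _).1 (Matrix.posDef_gram_of_linearIndependent hv).isUnit
  have hN : (Matrix.of fun i j => inner ℝ (w i) (v j)) = Matrix.of C * Matrix.gram ℝ v := by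
    ext i j
    simp [Matrix.mul_apply, ← hC i, sum_inner, inner_smul_left, Matrix.gram_apply]
  have hG : Matrix.gram ℝ w = Matrix.of C * Matrix.gram ℝ v * (Matrix.of C).transpose := by
    ext i j
    rw [← hN]
    simp only [Matrix.mul_apply, Matrix.gram_apply, Matrix.of_apply, Matrix.transpose_apply]
    conv_lhs => rw [← hC j]
    simp [inner_sum, inner_smul_right, mul_comm]
  have hs : (Matrix.gram ℝ v).transpose = Matrix.gram ℝ v := by
    ext i j
    simp [Matrix.gram_apply, real_inner_comm]
  rw [hN, hG, Matrix.transpose_mul, hs, Matrix.mul_nonsing_inv_cancel_right _ _ hu,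
    Matrix.mul_assoc]

variable {F : Type*} [AddCommGroup F] [Module ℝ F]

/-- The gradient of a linear form with respect to a pulled back inner product, in a frame. -/
theorem isGradient_iff_eq_sum {b : ι → F} {L : F →ₗ[ℝ] E} {η : F →ₗ[ℝ] ℝ}
    (hL : LinearIndependent ℝ (L ∘ b)) {c : ι → ℝ}
    (hc : (Matrix.gram ℝ (L ∘ b)).mulVec c = η ∘ b) (w : F) :
    (w ∈ Submodule.span ℝ (Set.range b) ∧
      ∀ v ∈ Submodule.span ℝ (Set.range b), inner ℝ (L w) (L v) = η v) ↔
      w = ∑ a, c a • b a := by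
  have key : ∀ c' : ι → ℝ, ∀ a, (Matrix.gram ℝ (L ∘ b)).mulVec c' a =
      inner ℝ (L (∑ a, c' a • b a)) (L (b a)) := fun c' a => by
    simp [Matrix.mulVec, dotProduct, Matrix.gram_apply, sum_inner, inner_smul_left, mul_comm,
      real_inner_comm]
  constructor
  · rintro ⟨hw, hg⟩
    obtain ⟨c', rfl⟩ := (Submodule.mem_span_range_iff_exists_fun ℝ).1 hw
    have h : (Matrix.gram ℝ (L ∘ b)).mulVec c' = (Matrix.gram ℝ (L ∘ b)).mulVec c := by
      rw [hc]
      funext a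
      rw [key, hg _ (Submodule.subset_span ⟨a, rfl⟩)]
      rfl
    have := Matrix.mulVec_injective_of_isUnit (Matrix.posDef_gram_of_linearIndependent hL).isUnit h
    rw [this]
  · rintro rfl
    refine ⟨(Submodule.mem_span_range_iff_exists_fun ℝ).2 ⟨c, rfl⟩, fun v hv => ?_⟩
    -- Both sides are linear in `v`, so agreement on the frame extends to its span.
    have hle : Submodule.span ℝ (Set.range b) ≤
        LinearMap.eqLocus ((innerₗ E (L (∑ a, c a • b a))).comp L) η := by
      refine Submodule.span_le.2 ?_
      rintro _ ⟨a, rfl⟩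
      have := (key c a).symm.trans (congrFun hc a)
      exact this
    exact hle hv

/-- `R A² R = M (R R)⁻¹ M` for `A = R⁻¹ M R⁻¹`. -/
theorem mul_conj_inv_sq_mul {R M : Matrix ι ι ℝ} (hR : IsUnit R) :
    R * (R⁻¹ * M * R⁻¹) ^ 2 * R = M * (R * R)⁻¹ * M := by
  have h := (Matrix.isUnit_iff_isUnit_det _).1 hR
  rw [Matrix.mul_inv_rev, pow_two]
  simp only [Matrix.mul_assoc, Matrix.nonsing_inv_mul _ h, Matrix.mul_one,
    Matrix.mul_nonsing_inv_cancel_left _ _ h]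

end Gram

/-- Both parts hold for any convex set with nonempty interior. The closure statement serves the
symmetry of second derivatives at boundary points. -/
theorem uniqueDiffOn_halfSpace {d : ℕ} (j : Fin d) : UniqueDiffOn ℝ {x : Euc d | 0 ≤ x j} ∧
    closure (interior {x : Euc d | 0 ≤ x j}) = closure {x : Euc d | 0 ≤ x j} := by
  have hc : Convex ℝ {x : Euc d | 0 ≤ x j} := by
    intro a ha b hb s t hs ht _
    simp only [Set.mem_ofPred_eq] at *
    simpa using add_nonneg (mul_nonneg hs ha) (mul_nonneg ht hb)
  have hi : (interior {x : Euc d | 0 ≤ x j}).Nonempty := by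
    have ho : IsOpen {x : Euc d | 0 < x j} := isOpen_lt continuous_const (by fun_prop)
    refine ⟨EuclideanSpace.single j 1, interior_maximal ?_ ho ?_⟩
    · exact fun x (hx : 0 < x j) => hx.le
    · simp
  exact ⟨uniqueDiffOn_convex hc hi, hc.closure_interior_eq_closure_of_nonempty_interior hi⟩

/-! ### Geometry of `B` in a chart and the normal frame. -/

section Param

variable {d m k : ℕ} {B : Set (Euc m)} {V : Set (Euc d)} {ψ : Euc d → Euc m}

theorem IsLocalParam.uniqueDiffOn (hψ : IsLocalParam B V ψ) : UniqueDiffOn ℝ V := by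
  rcases hψ.domain with h | ⟨j, O, hO, rfl⟩
  · exact h.uniqueDiffOn
  · rw [Set.inter_comm]
    exact (uniqueDiffOn_halfSpace j).1.inter hO

theorem IsLocalParam.mem_closure_interior (hψ : IsLocalParam B V ψ) {x : Euc d} (hx : x ∈ V) :
    x ∈ closure (interior V) := by
  rcases hψ.domain with h | ⟨j, O, hO, rfl⟩
  · rw [h.interior_eq]
    exact subset_closure hx
  · rw [interior_inter, hO.interior_eq]
    refine hO.inter_closure ⟨hx.1, ?_⟩
    rw [(uniqueDiffOn_halfSpace j).2]
    exact subset_closure hx.2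

theorem IsLocalParam.hasFDerivWithinAt (hψ : IsLocalParam B V ψ) {x : Euc d} (hx : x ∈ V) :
    HasFDerivWithinAt ψ (fderivWithin ℝ ψ V x) V x :=
  ((hψ.smooth.differentiableOn (by simp)) x hx).hasFDerivWithinAt

/-- Continuity of the inverse chart, phrased with filters on the ambient space as
`tangentSpaceOf_eq_range` needs it. -/
theorem IsLocalParam.comap_nhds_le (hψ : IsLocalParam B V ψ) {x : Euc d} (hx : x ∈ V) :
    comap ψ (𝓝 (ψ x)) ⊓ 𝓟 V ≤ 𝓝 x := by
  have h := hψ.embedding.nhds_eq_comap ⟨x, hx⟩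
  have h2 : map ((↑) : V → Euc d) (𝓝 ⟨x, hx⟩) = 𝓝[V] x := map_nhds_subtype_val ⟨x, hx⟩
  have h3 : V.domRestrict ψ = ψ ∘ ((↑) : V → Euc d) := rfl
  rw [h, h3, ← comap_comap, map_comap, Subtype.range_coe] at h2
  change comap ψ (𝓝 (ψ x)) ⊓ 𝓟 V = 𝓝[V] x at h2
  rw [h2]
  exact nhdsWithin_le_nhds

theorem IsLocalParam.tangentSpaceOf_eq (hψ : IsLocalParam B V ψ) {x : Euc d} (hx : x ∈ V) :
    tangentSpaceOf B (ψ x) = LinearMap.range (fderivWithin ℝ ψ V x).toLinearMap := by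
  obtain ⟨W, hW, himg⟩ := hψ.image
  exact tangentSpaceOf_eq_range (hψ.hasFDerivWithinAt hx) (hψ.immersion x hx)
    (hψ.uniqueDiffOn x hx) hx hW himg (hψ.comap_nhds_le hx)

theorem IsLocalParam.partialX_mem (hψ : IsLocalParam B V ψ) {x : Euc d} (hx : x ∈ V) (i : Fin d) :
    partialX V ψ i x ∈ tangentSpaceOf B (ψ x) := by
  rw [hψ.tangentSpaceOf_eq hx]
  exact ⟨_, rfl⟩

theorem apply_eq_sum_single {F : Type*} [AddCommGroup F] [Module ℝ F] (f : Euc d →ₗ[ℝ] F)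
    (u : Euc d) : f u = ∑ i, u i • f (EuclideanSpace.single i 1) := by
  conv_lhs => rw [← (EuclideanSpace.basisFun (Fin d) ℝ).sum_repr u]
  simp

theorem IsLocalParam.span_partialX (hψ : IsLocalParam B V ψ) {x : Euc d} (hx : x ∈ V) :
    Submodule.span ℝ (Set.range fun i => partialX V ψ i x) = tangentSpaceOf B (ψ x) := by
  apply le_antisymm
  · refine Submodule.span_le.2 ?_
    rintro _ ⟨i, rfl⟩
    exact hψ.partialX_mem hx i
  · rw [hψ.tangentSpaceOf_eq hx]
    rintro _ ⟨u, rfl⟩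
    rw [apply_eq_sum_single]
    exact Submodule.sum_mem _ fun i _ =>
      Submodule.smul_mem _ _ (Submodule.subset_span ⟨i, rfl⟩)

theorem linearIndependent_single (d : ℕ) :
    LinearIndependent ℝ fun i : Fin d => (EuclideanSpace.single i 1 : Euc d) := by
  have h : (fun i : Fin d => (EuclideanSpace.single i 1 : Euc d)) =
      EuclideanSpace.basisFun (Fin d) ℝ := by
    funext i
    simp
  rw [h]
  exact (EuclideanSpace.basisFun (Fin d) ℝ).orthonormal.linearIndependent

theorem IsLocalParam.linearIndependent_partialX (hψ : IsLocalParam B V ψ) {x : Euc d}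
    (hx : x ∈ V) : LinearIndependent ℝ fun i => partialX V ψ i x :=
  (linearIndependent_single d).map_injOn (fderivWithin ℝ ψ V x).toLinearMap
    (hψ.immersion x hx).injOn

theorem IsLocalParam.contDiffOn_partialX (hψ : IsLocalParam B V ψ) (i : Fin d) :
    ContDiffOn ℝ ∞ (partialX V ψ i) V :=
  (hψ.smooth.fderivWithin hψ.uniqueDiffOn (by simp)).clm_apply contDiffOn_const

/-- Symmetry of the second derivative, valid also at the boundary because `V` lies in the closure of
its interior. It makes `H_α` symmetric. -/
theorem IsLocalParam.partialX_comm (hψ : IsLocalParam B V ψ) {x : Euc d} (hx : x ∈ V)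
    (i j : Fin d) : partialX V (partialX V ψ j) i x = partialX V (partialX V ψ i) j x := by
  have hd : DifferentiableWithinAt ℝ (fderivWithin ℝ ψ V) V x :=
    (hψ.smooth.fderivWithin (m := ∞) hψ.uniqueDiffOn (by simp)).differentiableOn (by simp) x hx
  have key : ∀ i j, partialX V (partialX V ψ j) i x =
      fderivWithin ℝ (fderivWithin ℝ ψ V) V x (EuclideanSpace.single i 1)
        (EuclideanSpace.single j 1) := fun i j => by
    have := (hd.hasFDerivWithinAt.clm_apply (hasFDerivWithinAt_const
      (EuclideanSpace.single j 1 : Euc d) x V)).fderivWithin (hψ.uniqueDiffOn x hx)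
    unfold partialX
    rw [this]
    simp
  rw [key, key]
  exact (hψ.smooth x hx).isSymmSndFDerivWithinAt (by
    rw [minSmoothness_of_isRCLikeNormedField]
    exact WithTop.coe_le_coe.2 (le_top (a := (2 : ℕ∞)))) hψ.uniqueDiffOn
    (hψ.mem_closure_interior hx) hx _ _

section Frame

variable {e : Fin k → Euc d → Euc m}

/-- The Weingarten equation `⟨∂ᵢ e_α, ∂ⱼ⟩ = -⟨e_α, ∂ᵢ ∂ⱼ⟩`. -/
theorem IsNormalFrame.inner_partialX (he : IsNormalFrame B V ψ e) (hψ : IsLocalParam B V ψ)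
    {x : Euc d} (hx : x ∈ V) (α : Fin k) (i j : Fin d) :
    inner ℝ (partialX V (e α) i x) (partialX V ψ j x) =
      -inner ℝ (e α x) (partialX V (partialX V ψ j) i x) := by
  have h1 := ((he.smooth α).differentiableOn (by simp) x hx).hasFDerivWithinAt
  have h2 := ((hψ.contDiffOn_partialX j).differentiableOn (by simp) x hx).hasFDerivWithinAt
  have h3 := h1.inner ℝ h2
  -- The inner product `⟨e_α, ∂ⱼψ⟩` vanishes identically on `V`, so the product rule for it has
  -- total zero.
  have h0 : HasFDerivWithinAt (fun y => inner ℝ (e α y) (partialX V ψ j y))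
      (0 : Euc d →L[ℝ] ℝ) V x := by
    refine (hasFDerivWithinAt_const (0 : ℝ) x V).congr (fun y hy => ?_) ?_
    · exact (Submodule.mem_orthogonal' _ _).1 (he.normal y hy α) _ (hψ.partialX_mem hy j)
    · exact (Submodule.mem_orthogonal' _ _).1 (he.normal x hx α) _ (hψ.partialX_mem hx j)
  have h4 := (hψ.uniqueDiffOn x hx).eq h3 h0
  have h5 := congrArg (fun l : Euc d →L[ℝ] ℝ => l (EuclideanSpace.single i 1)) h4
  simp [fderivInnerCLM_apply] at h5
  unfold partialX at *
  linarith

/-- The projection is self-adjoint and fixes `v`. This removes the normal projections from `H_α` and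
`Γ_β`, leaving plain Euclidean derivatives. -/
theorem inner_starProjection_orthogonal {T : Submodule ℝ (Euc m)} {v : Euc m} (hv : v ∈ Tᗮ)
    (w : Euc m) : inner ℝ v (Tᗮ.starProjection w) = inner ℝ v w := by
  rw [← Submodule.inner_starProjection_left_eq_right,
    Submodule.starProjection_eq_self_iff.2 hv]

theorem IsNormalFrame.shapeMatrix_apply (he : IsNormalFrame B V ψ e) {x : Euc d} (hx : x ∈ V)
    (α : Fin k) (i j : Fin d) :
    shapeMatrix B V ψ e x α i j = inner ℝ (e α x) (partialX V (partialX V ψ j) i x) :=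
  inner_starProjection_orthogonal (he.normal x hx α) _

theorem IsNormalFrame.connectionMatrix_apply (he : IsNormalFrame B V ψ e) {x : Euc d} (hx : x ∈ V)
    (β α : Fin k) (j : Fin d) :
    connectionMatrix B V ψ e x β j α = inner ℝ (partialX V (e β) j x) (e α x) := by
  rw [real_inner_comm]
  exact (real_inner_comm _ _).trans (inner_starProjection_orthogonal (he.normal x hx α) _)

end Frame

end Param

section FullFrame

variable {d k : ℕ} {B : Set (Euc (d + k))} {V : Set (Euc d)} {ψ : Euc d → Euc (d + k)}
  {e : Fin k → Euc d → Euc (d + k)}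

/-- Dimension count: the tangent space has dimension `d` in `ℝ^{d+k}`, and `k` orthonormal normal
vectors fill its complement. -/
theorem IsNormalFrame.span_eq (he : IsNormalFrame B V ψ e) (hψ : IsLocalParam B V ψ)
    {x : Euc d} (hx : x ∈ V) :
    Submodule.span ℝ (Set.range fun α => e α x) = (tangentSpaceOf B (ψ x))ᗮ := by
  refine Submodule.eq_of_le_of_finrank_eq (Submodule.span_le.2 ?_) ?_
  · rintro _ ⟨α, rfl⟩
    exact he.normal x hx α
  · rw [finrank_span_eq_card (he.orthonormal x hx).linearIndependent]
    have h1 := Submodule.finrank_add_finrank_orthogonal (tangentSpaceOf B (ψ x))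
    have h2 : Module.finrank ℝ (tangentSpaceOf B (ψ x)) = d := by
      rw [← hψ.span_partialX hx, finrank_span_eq_card (hψ.linearIndependent_partialX hx)]
      simp
    rw [h2] at h1
    simp at h1
    simp [h1]

end FullFrame

/-! ### Parametrization of the normal bundle and its tangent spaces. -/

section BundleParam

variable {d m k : ℕ} {B : Set (Euc m)} {V : Set (Euc d)} {ψ : Euc d → Euc m}
  {e : Fin k → Euc d → Euc m}

theorem norm_sum_smul_of_orthonormal {v : Fin k → Euc m} (hv : Orthonormal ℝ v) (n : Euc k) :
    ‖∑ α, n α • v α‖ = ‖n‖ := by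
  rw [← sq_eq_sq₀ (norm_nonneg _) (norm_nonneg _), ← real_inner_self_eq_norm_sq,
    hv.inner_sum, EuclideanSpace.real_norm_sq_eq]
  simp [pow_two]

theorem IsLocalParam.uniqueDiffOn_coordDomain (hψ : IsLocalParam B V ψ) (k : ℕ) (r : ℝ) :
    UniqueDiffOn ℝ (coordDomain k V r) :=
  hψ.uniqueDiffOn.prod Metric.isOpen_ball.uniqueDiffOn

/-- The derivative of the parametrization of the normal bundle. -/
noncomputable def bundleDeriv (V : Set (Euc d)) (ψ : Euc d → Euc m) (e : Fin k → Euc d → Euc m)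
    (q : Euc d × Euc k) : Euc d × Euc k →L[ℝ] Euc m × Euc m :=
  ((fderivWithin ℝ ψ V q.1).comp (ContinuousLinearMap.fst ℝ _ _)).prod
    (∑ α, (q.2 α • (fderivWithin ℝ (e α) V q.1).comp (ContinuousLinearMap.fst ℝ _ _) +
      ((EuclideanSpace.proj α).comp (ContinuousLinearMap.snd ℝ _ _)).smulRight (e α q.1)))

theorem bundleDeriv_apply (q u : Euc d × Euc k) : bundleDeriv V ψ e q u =
    (fderivWithin ℝ ψ V q.1 u.1,
      ∑ α, (q.2 α • fderivWithin ℝ (e α) V q.1 u.1 + u.2 α • e α q.1)) := by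
  simp [bundleDeriv]

theorem IsNormalFrame.hasFDerivWithinAt_bundleParam (he : IsNormalFrame B V ψ e)
    (hψ : IsLocalParam B V ψ) {r : ℝ} {q : Euc d × Euc k} (hq : q ∈ coordDomain k V r) :
    HasFDerivWithinAt (bundleParam ψ e) (bundleDeriv V ψ e q) (coordDomain k V r) q := by
  have hm : Set.MapsTo Prod.fst (coordDomain k V r) V := fun y hy => hy.1
  have hf : HasFDerivWithinAt (Prod.fst : Euc d × Euc k → Euc d)
    (ContinuousLinearMap.fst ℝ _ _) (coordDomain k V r) q := hasFDerivWithinAt_fst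
  have hsn : HasFDerivWithinAt (Prod.snd : Euc d × Euc k → Euc k)
    (ContinuousLinearMap.snd ℝ _ _) (coordDomain k V r) q := hasFDerivWithinAt_snd
  refine ((hψ.hasFDerivWithinAt hq.1).comp q hf hm).prodMk ?_
  refine HasFDerivWithinAt.fun_sum fun α _ => ?_
  have h1 : HasFDerivWithinAt (fun y : Euc d × Euc k => y.2 α)
      ((EuclideanSpace.proj α).comp (ContinuousLinearMap.snd ℝ _ _)) (coordDomain k V r) q :=
    (EuclideanSpace.proj α : Euc k →L[ℝ] ℝ).hasFDerivAt.comp_hasFDerivWithinAt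
      q hsn
  exact h1.smul ((((he.smooth α).differentiableOn (by simp)
    q.1 hq.1).hasFDerivWithinAt).comp q hf hm)

theorem IsNormalFrame.fderivWithin_bundleParam (he : IsNormalFrame B V ψ e)
    (hψ : IsLocalParam B V ψ) {r : ℝ} {q : Euc d × Euc k} (hq : q ∈ coordDomain k V r) :
    fderivWithin ℝ (bundleParam ψ e) (coordDomain k V r) q = bundleDeriv V ψ e q :=
  (he.hasFDerivWithinAt_bundleParam hψ hq).fderivWithin (hψ.uniqueDiffOn_coordDomain k r q hq)

theorem IsNormalFrame.bundleDeriv_injective (he : IsNormalFrame B V ψ e)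
    (hψ : IsLocalParam B V ψ) {q : Euc d × Euc k} (hq : q.1 ∈ V) :
    Function.Injective (bundleDeriv V ψ e q) := by
  refine (injective_iff_map_eq_zero _).2 fun u hu => ?_
  rw [bundleDeriv_apply, Prod.mk_eq_zero] at hu
  have h1 : u.1 = 0 := (injective_iff_map_eq_zero _).1 (hψ.immersion q.1 hq) _ hu.1
  have h2 := hu.2
  simp only [h1, map_zero, smul_zero, zero_add] at h2
  have h3 := Fintype.linearIndependent_iff.1 (he.orthonormal q.1 hq).linearIndependent _ h2
  exact Prod.ext h1 (by ext α; exact h3 α)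

theorem IsNormalFrame.mapsTo_bundleParam (he : IsNormalFrame B V ψ e)
    (hψ : IsLocalParam B V ψ) (r : ℝ) :
    Set.MapsTo (bundleParam ψ e) (coordDomain k V r) (normalBundle B r) := by
  rintro ⟨x, n⟩ ⟨hx, hn⟩
  obtain ⟨W, hW, himg⟩ := hψ.image
  refine ⟨(himg ▸ Set.mem_image_of_mem ψ hx : ψ x ∈ B ∩ W).1, ?_, ?_⟩
  · exact Submodule.sum_mem _ fun α _ => Submodule.smul_mem _ _ (he.normal x hx α)
  · change ‖∑ α, n α • e α x‖ < r
    rw [norm_sum_smul_of_orthonormal (he.orthonormal x hx)]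
    simpa using hn

/-- Continuity of the inverse coordinates: `x` is recovered through the chart, and then `n^α =
⟨e_α(x), ν⟩` depends continuously on the point. -/
theorem IsNormalFrame.comap_nhds_le (he : IsNormalFrame B V ψ e)
    (hψ : IsLocalParam B V ψ) {r : ℝ} {q : Euc d × Euc k} (hq : q ∈ coordDomain k V r) :
    comap (bundleParam ψ e) (𝓝 (bundleParam ψ e q)) ⊓ 𝓟 (coordDomain k V r) ≤ 𝓝 q := by
  set l := comap (bundleParam ψ e) (𝓝 (bundleParam ψ e q)) ⊓ 𝓟 (coordDomain k V r) with hl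
  have hF : Tendsto (bundleParam ψ e) l (𝓝 (bundleParam ψ e q)) :=
    tendsto_comap.mono_left inf_le_left
  have hD : ∀ᶠ y in l, y ∈ coordDomain k V r :=
    Filter.mem_of_superset (mem_inf_of_right (mem_principal_self _)) fun y hy => hy
  have h1 : Tendsto (fun y : Euc d × Euc k => y.1) l (𝓝 q.1) := by
    refine Tendsto.mono_right ?_ (hψ.comap_nhds_le hq.1)
    refine tendsto_inf.2 ⟨tendsto_comap_iff.2 ?_, tendsto_principal.2 (hD.mono fun y hy => hy.1)⟩
    exact (continuous_fst.tendsto _).comp hF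
  have h1' : Tendsto (fun y : Euc d × Euc k => y.1) l (𝓝[V] q.1) :=
    tendsto_nhdsWithin_iff.2 ⟨h1, hD.mono fun y hy => hy.1⟩
  have h2 : ∀ α, Tendsto (fun y : Euc d × Euc k => y.2 α) l (𝓝 (q.2 α)) := fun α => by
    have ha : Tendsto (fun y : Euc d × Euc k => e α y.1) l (𝓝 (e α q.1)) :=
      ((he.smooth α).continuousOn q.1 hq.1).tendsto.comp h1'
    have hb : Tendsto (fun y : Euc d × Euc k => (bundleParam ψ e y).2) l
      (𝓝 (bundleParam ψ e q).2) := (continuous_snd.tendsto _).comp hF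
    have key : ∀ y ∈ coordDomain k V r, inner ℝ (e α y.1) (bundleParam ψ e y).2 = y.2 α :=
      fun y hy => (he.orthonormal y.1 hy.1).inner_right_fintype _ _
    rw [← key q hq]
    exact (ha.inner hb).congr' (hD.mono fun y hy => key y hy)
  have h3 : Tendsto (fun y : Euc d × Euc k => y.2) l (𝓝 q.2) := by
    have := tendsto_pi_nhds.2 h2
    exact ((PiLp.continuous_toLp 2 (fun _ : Fin k => ℝ)).tendsto _).comp this
  exact (h1.prodMk_nhds h3 : Tendsto id l (𝓝 q))

end BundleParam

section FullBundle

variable {d k : ℕ} {B : Set (Euc (d + k))} {V : Set (Euc d)} {ψ : Euc d → Euc (d + k)}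
  {e : Fin k → Euc d → Euc (d + k)}

theorem IsNormalFrame.tangentSpaceOf_normalBundle (he : IsNormalFrame B V ψ e)
    (hψ : IsLocalParam B V ψ) {r : ℝ} {q : Euc d × Euc k} (hq : q ∈ coordDomain k V r) :
    tangentSpaceOf (normalBundle B r) (bundleParam ψ e q) =
      LinearMap.range (bundleDeriv V ψ e q).toLinearMap := by
  obtain ⟨W, hW, himg⟩ := hψ.image
  refine tangentSpaceOf_eq_range (W := W ×ˢ Set.univ)
    (he.hasFDerivWithinAt_bundleParam hψ hq) (he.bundleDeriv_injective hψ hq.1)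
    (hψ.uniqueDiffOn_coordDomain k r q hq) hq (hW.prod isOpen_univ) ?_ (he.comap_nhds_le hψ hq)
  -- The patch is exactly the part of the bundle over `W`: the frame spans each normal space, and
  -- orthonormality identifies `|n| < r` with `|ν| < r`.
  apply Set.Subset.antisymm
  · rintro _ ⟨y, hy, rfl⟩
    refine ⟨he.mapsTo_bundleParam hψ r hy, ?_, trivial⟩
    exact (himg ▸ Set.mem_image_of_mem ψ hy.1 : ψ y.1 ∈ B ∩ W).2
  · rintro ⟨b, ν⟩ ⟨⟨hb, hν, hr⟩, hbW, -⟩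
    obtain ⟨x, hx, rfl⟩ : b ∈ ψ '' V := himg ▸ ⟨hb, hbW⟩
    simp only at hν hr
    rw [← he.span_eq hψ hx] at hν
    obtain ⟨c, rfl⟩ := (Submodule.mem_span_range_iff_exists_fun ℝ).1 hν
    refine ⟨(x, WithLp.toLp 2 c), ⟨hx, ?_⟩, rfl⟩
    rw [mem_ball_zero_iff, ← norm_sum_smul_of_orthonormal (he.orthonormal x hx)]
    exact hr

end FullBundle

/-! ### The scaled metric, its nondegeneracy and the adapted frame. -/

/-- The derivative of `Φ ∘ S_ε`. -/
noncomputable def pushMap (m : ℕ) (ε : ℝ) : Euc m × Euc m →L[ℝ] Euc m :=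
  ContinuousLinearMap.fst ℝ _ _ + ε • ContinuousLinearMap.snd ℝ _ _

theorem pushMap_apply {m : ℕ} (ε : ℝ) (u : Euc m × Euc m) : pushMap m ε u = u.1 + ε • u.2 := by
  simp [pushMap]

theorem scaledMetric_eq {m : ℕ} (ε : ℝ) (p u v : Euc m × Euc m) :
    scaledMetric ε p u v = inner ℝ (pushMap m ε u) (pushMap m ε v) := by
  have h1 : ∀ p : Euc m × Euc m, fderiv ℝ (scalingMap ε) p =
      (ContinuousLinearMap.fst ℝ (Euc m) (Euc m)).prod
        (ε • ContinuousLinearMap.snd ℝ (Euc m) (Euc m)) := fun p =>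
    ((ContinuousLinearMap.fst ℝ (Euc m) (Euc m)).prod
        (ε • ContinuousLinearMap.snd ℝ (Euc m) (Euc m))).fderiv
  have h2 : ∀ p : Euc m × Euc m, fderiv ℝ tubeMap p =
      ContinuousLinearMap.fst ℝ (Euc m) (Euc m) + ContinuousLinearMap.snd ℝ (Euc m) (Euc m) :=
    fun p => (ContinuousLinearMap.fst ℝ (Euc m) (Euc m) +
      ContinuousLinearMap.snd ℝ (Euc m) (Euc m)).fderiv
  simp [scaledMetric, pullback, euclideanMetric, h1, h2, pushMap_apply]

section Adapted

variable {d m k : ℕ} {B : Set (Euc m)} {V : Set (Euc d)} {ψ : Euc d → Euc m}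
  {e : Fin k → Euc d → Euc m}

/-- Inside a tubular radius, `g_ε` is nondegenerate on the tangent spaces of the normal bundle. -/
theorem IsTubularRadius.injective_pushMap_comp {r : ℝ} (hr : IsTubularRadius B r)
    (he : IsNormalFrame B V ψ e) (hψ : IsLocalParam B V ψ) {ε : ℝ} (hε0 : 0 < ε) (hε1 : ε < 1)
    {x : Euc d} {n : Euc k} (hxn : (x, n) ∈ coordDomain k V r) :
    Function.Injective ((pushMap m ε).comp (bundleDeriv V ψ e (x, n))) := by
  obtain ⟨-, Ξ, hΞ, hinv⟩ := hr
  -- The immersion property of `Φ` is used at `S_ε (x, n)`, which stays in the tube since `ε < 1`.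
  have hq : (x, ε • n) ∈ coordDomain k V r := by
    refine ⟨hxn.1, ?_⟩
    have h := hxn.2
    simp only [mem_ball_zero_iff, norm_smul, Real.norm_eq_abs, abs_of_pos hε0] at h ⊢
    nlinarith [norm_nonneg n]
  have hF := he.hasFDerivWithinAt_bundleParam hψ hq
  have hmaps := he.mapsTo_bundleParam hψ r
  have hT : HasFDerivWithinAt (tubeMap ∘ bundleParam ψ e)
      ((pushMap m 1).comp (bundleDeriv V ψ e (x, ε • n))) (coordDomain k V r) (x, ε • n) := by
    have h := (pushMap m 1).hasFDerivAt.comp_hasFDerivWithinAt _ hF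
    have hfun : tubeMap ∘ bundleParam ψ e = pushMap m 1 ∘ bundleParam ψ e := by
      funext y
      simp [pushMap_apply, tubeMap]
    rw [hfun]
    exact h
  have hX := ((hΞ.differentiableOn (by simp)) (tubeMap (bundleParam ψ e (x, ε • n)))
    ⟨_, hmaps hq, rfl⟩).hasFDerivWithinAt
  have hcomp := HasFDerivWithinAt.comp (x, ε • n) hX hT
    (fun y hy => Set.mem_image_of_mem tubeMap (hmaps hy))
  have hcomp' : HasFDerivWithinAt (bundleParam ψ e) _ (coordDomain k V r) (x, ε • n) :=
    hcomp.congr (fun y hy => (hinv (hmaps hy)).symm) (hinv (hmaps hq)).symm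
  -- Differentiating `Ξ ∘ Φ ∘ bundleParam = bundleParam` shows that the kernel of the derivative of
  -- `Φ ∘ bundleParam` lies in that of `bundleDeriv`, which is zero.
  have heq := (hψ.uniqueDiffOn_coordDomain k r _ hq).eq hcomp' hF
  refine (injective_iff_map_eq_zero _).2 fun u hu => ?_
  -- In coordinates `S_ε` is `(x, n) ↦ (x, ε n)`; by the chain rule it carries `u` to `(u.1, ε
  -- u.2)`.
  have h1 : (pushMap m 1).comp (bundleDeriv V ψ e (x, ε • n)) (u.1, ε • u.2) = 0 := by
    rw [← hu]
    simp only [ContinuousLinearMap.comp_apply, pushMap_apply, bundleDeriv_apply,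
      Finset.smul_sum, smul_add, smul_smul, PiLp.smul_apply, smul_eq_mul, one_mul]
  have h2 : bundleDeriv V ψ e (x, ε • n) (u.1, ε • u.2) = 0 := by
    rw [← heq, ContinuousLinearMap.comp_apply, h1, map_zero]
  have h3 := (injective_iff_map_eq_zero _).1 (he.bundleDeriv_injective hψ hq.1) _ h2
  rw [Prod.mk_eq_zero, smul_eq_zero_iff_right hε0.ne'] at h3
  exact Prod.ext h3.1 h3.2

variable {r : ℝ} {x : Euc d} {n : Euc k}

theorem IsNormalFrame.coordField_eq (he : IsNormalFrame B V ψ e) (hψ : IsLocalParam B V ψ)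
    (hxn : (x, n) ∈ coordDomain k V r) (i : Fin d) :
    coordField V r ψ e (x, n) i =
      (partialX V ψ i x, ∑ β, n β • partialX V (e β) i x) := by
  rw [coordField, he.fderivWithin_bundleParam hψ hxn, bundleDeriv_apply]
  simp [partialX]

theorem IsNormalFrame.fibreField_eq (he : IsNormalFrame B V ψ e) (hψ : IsLocalParam B V ψ)
    (hxn : (x, n) ∈ coordDomain k V r) (α : Fin k) :
    fibreField V r ψ e (x, n) α = (0, e α x) := by
  rw [fibreField, he.fderivWithin_bundleParam hψ hxn, bundleDeriv_apply]
  simp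

/-- The Gram–Schmidt quotient has numerator `ε² n^β ⟨∂ᵢ e_β, e_α⟩` and denominator `ε²`, so `ε`
cancels. -/
theorem IsNormalFrame.horizontalField_eq_sub (he : IsNormalFrame B V ψ e)
    (hψ : IsLocalParam B V ψ) (hxn : (x, n) ∈ coordDomain k V r) {ε : ℝ} (hε : ε ≠ 0)
    (i : Fin d) :
    horizontalField V r ε ψ e (x, n) i = coordField V r ψ e (x, n) i -
      ∑ α, (∑ β, n β • connectionMatrix B V ψ e x β) i α • fibreField V r ψ e (x, n) α := by
  rw [horizontalField]
  congr 1
  refine Finset.sum_congr rfl fun α _ => ?_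
  congr 1
  rw [scaledMetric_eq, scaledMetric_eq, he.coordField_eq hψ hxn, he.fibreField_eq hψ hxn,
    pushMap_apply, pushMap_apply]
  have h0 : inner ℝ (partialX V ψ i x) (e α x) = 0 :=
    (Submodule.mem_orthogonal _ _).1 (he.normal x hxn.1 α) _ (hψ.partialX_mem hxn.1 i)
  have h1 : inner ℝ (e α x) (e α x) = (1 : ℝ) := by
    rw [real_inner_self_eq_norm_sq, (he.orthonormal x hxn.1).1 α, one_pow]
  simp only [zero_add, inner_add_left, inner_smul_left, inner_smul_right, h0, h1, sum_inner,
    Matrix.sum_apply, Matrix.smul_apply, he.connectionMatrix_apply hxn.1, conj_trivial,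
    smul_eq_mul]
  field_simp

/-- The pushforward of `∂ᵢ^H`, paired with the tangent vectors of `B`. -/
theorem IsNormalFrame.inner_pushMap_horizontalField (he : IsNormalFrame B V ψ e)
    (hψ : IsLocalParam B V ψ) (hxn : (x, n) ∈ coordDomain k V r) {ε : ℝ} (hε : ε ≠ 0)
    (i j : Fin d) :
    inner ℝ (pushMap m ε (horizontalField V r ε ψ e (x, n) i)) (partialX V ψ j x) =
      (metricB V ψ x - ε • ∑ α, n α • shapeMatrix B V ψ e x α) i j := by
  have h0 : ∀ α, inner ℝ (e α x) (partialX V ψ j x) = (0 : ℝ) := fun α =>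
    (Submodule.mem_orthogonal' _ _).1 (he.normal x hxn.1 α) _ (hψ.partialX_mem hxn.1 j)
  rw [he.horizontalField_eq_sub hψ hxn hε, map_sub, map_sum, he.coordField_eq hψ hxn,
    pushMap_apply]
  simp only [map_smul, he.fibreField_eq hψ hxn, pushMap_apply, inner_sub_left, inner_add_left,
    sum_inner, inner_smul_left, h0, he.inner_partialX hψ hxn.1, Matrix.sub_apply,
    Matrix.smul_apply, Matrix.sum_apply, he.shapeMatrix_apply hxn.1, metricB, Matrix.of_apply]
  simp [sub_eq_add_neg]

theorem IsNormalFrame.inner_pushMap_fibreField (he : IsNormalFrame B V ψ e)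
    (hψ : IsLocalParam B V ψ) (hxn : (x, n) ∈ coordDomain k V r) (ε : ℝ) (α β : Fin k) :
    inner ℝ (pushMap m ε (fibreField V r ψ e (x, n) α)) (pushMap m ε (fibreField V r ψ e (x, n) β))
      = (ε ^ 2 • (1 : Matrix (Fin k) (Fin k) ℝ)) α β := by
  rw [he.fibreField_eq hψ hxn, he.fibreField_eq hψ hxn, pushMap_apply, pushMap_apply]
  simp [inner_smul_left, inner_smul_right, orthonormal_iff_ite.1 (he.orthonormal x hxn.1),
    Matrix.one_apply, pow_two]

theorem IsNormalFrame.inner_pushMap_horizontalField_fibreField (he : IsNormalFrame B V ψ e)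
    (hψ : IsLocalParam B V ψ) (hxn : (x, n) ∈ coordDomain k V r) {ε : ℝ} (hε : ε ≠ 0)
    (i : Fin d) (α : Fin k) :
    inner ℝ (pushMap m ε (horizontalField V r ε ψ e (x, n) i))
      (pushMap m ε (fibreField V r ψ e (x, n) α)) = (0 : ℝ) := by
  have h := he.inner_pushMap_fibreField hψ hxn ε
  rw [horizontalField, map_sub, map_sum, inner_sub_left, sum_inner]
  simp only [map_smul, inner_smul_left, scaledMetric_eq, h, Matrix.smul_apply, Matrix.one_apply,
    conj_trivial]
  simp [hε]

/-- Orthogonality to the pushed fibre fields `ε e_α` is orthogonality to the whole normal space, so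
the vector lies in the double orthogonal complement of the tangent space. -/
theorem IsNormalFrame.pushMap_horizontalField_mem {d k : ℕ} {B : Set (Euc (d + k))}
    {V : Set (Euc d)} {ψ : Euc d → Euc (d + k)} {e : Fin k → Euc d → Euc (d + k)} {x : Euc d}
    {n : Euc k} (he : IsNormalFrame B V ψ e)
    (hψ : IsLocalParam B V ψ) (hxn : (x, n) ∈ coordDomain k V r) {ε : ℝ} (hε : ε ≠ 0)
    (i : Fin d) :
    pushMap (d + k) ε (horizontalField V r ε ψ e (x, n) i) ∈
      Submodule.span ℝ (Set.range fun i => partialX V ψ i x) := by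
  rw [hψ.span_partialX hxn.1, ← Submodule.orthogonal_orthogonal (tangentSpaceOf B (ψ x)),
    ← he.span_eq hψ hxn.1]
  refine (Submodule.mem_orthogonal' _ _).2 fun v hv => ?_
  obtain ⟨c, rfl⟩ := (Submodule.mem_span_range_iff_exists_fun ℝ).1 hv
  rw [inner_sum]
  refine Finset.sum_eq_zero fun α _ => ?_
  have h := he.inner_pushMap_horizontalField_fibreField hψ hxn hε i α
  rw [he.fibreField_eq hψ hxn, pushMap_apply ε (0, e α x), zero_add, inner_smul_right] at h
  rw [inner_smul_right, (mul_eq_zero.1 h).resolve_left hε, mul_zero]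

/-- The adapted frame in the coordinates `(x, n)`, when `c` is the matrix of the projections of
the fields `∂ᵢ` to the fibres. -/
noncomputable def modelFrame (c : Matrix (Fin d) (Fin k) ℝ) : Fin d ⊕ Fin k → Euc d × Euc k :=
  Sum.elim (fun i => (EuclideanSpace.single i 1, 0) - ∑ α, c i α • (0, EuclideanSpace.single α 1))
    fun α => (0, EuclideanSpace.single α 1)

/-- The change from the coordinate basis is unitriangular: adding back the fibre vectors recovers
each `∂ᵢ`. -/
theorem span_modelFrame (c : Matrix (Fin d) (Fin k) ℝ) :
    Submodule.span ℝ (Set.range (modelFrame c)) = ⊤ := by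
  have hf : ∀ α, ((0, EuclideanSpace.single α 1) : Euc d × Euc k) ∈
      Submodule.span ℝ (Set.range (modelFrame c)) := fun α =>
    Submodule.subset_span ⟨Sum.inr α, rfl⟩
  have hc : ∀ i, ((EuclideanSpace.single i 1, 0) : Euc d × Euc k) ∈
      Submodule.span ℝ (Set.range (modelFrame c)) := fun i => by
    have h : modelFrame c (Sum.inl i) ∈ Submodule.span ℝ (Set.range (modelFrame c)) :=
      Submodule.subset_span ⟨Sum.inl i, rfl⟩
    have h' := Submodule.add_mem _ h (Submodule.sum_mem _ fun α (_ : α ∈ Finset.univ) =>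
      Submodule.smul_mem _ (c i α) (hf α))
    simpa [modelFrame] using h'
  refine eq_top_iff.2 fun u _ => ?_
  have h1 := apply_eq_sum_single (LinearMap.inl ℝ (Euc d) (Euc k)) u.1
  have h2 := apply_eq_sum_single (LinearMap.inr ℝ (Euc d) (Euc k)) u.2
  have hu : u = LinearMap.inl ℝ (Euc d) (Euc k) u.1 + LinearMap.inr ℝ (Euc d) (Euc k) u.2 := by
    simp
  rw [hu, h1, h2]
  exact Submodule.add_mem _
    (Submodule.sum_mem _ fun i _ => Submodule.smul_mem _ _ (hc i))
    (Submodule.sum_mem _ fun i _ => Submodule.smul_mem _ _ (hf i))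

theorem linearIndependent_modelFrame (c : Matrix (Fin d) (Fin k) ℝ) :
    LinearIndependent ℝ (modelFrame c) :=
  linearIndependent_of_top_le_span_of_card_eq_finrank (span_modelFrame c).ge (by simp)

theorem IsNormalFrame.adaptedFrame_eq (he : IsNormalFrame B V ψ e)
    (hψ : IsLocalParam B V ψ) (hxn : (x, n) ∈ coordDomain k V r) {ε : ℝ} (hε : ε ≠ 0) :
    adaptedFrame V r ε ψ e (x, n) = bundleDeriv V ψ e (x, n) ∘
      modelFrame (∑ β, n β • connectionMatrix B V ψ e x β) := by
  funext a
  rcases a with i | α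
  · simp only [adaptedFrame, Sum.elim_inl, Function.comp, modelFrame, map_sub, map_sum, map_smul,
      he.horizontalField_eq_sub hψ hxn hε, coordField, fibreField,
      he.fderivWithin_bundleParam hψ hxn]
  · simp only [adaptedFrame, Sum.elim_inr, Function.comp, modelFrame, fibreField,
      he.fderivWithin_bundleParam hψ hxn]

theorem metricBSqrt_mul_self (V : Set (Euc d)) (ψ : Euc d → Euc m) (x : Euc d) :
    metricBSqrt V ψ x * metricBSqrt V ψ x = metricB V ψ x :=
  CFC.sqrt_mul_sqrt_self _ (Matrix.nonneg_iff_posSemidef.2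
    (Matrix.posSemidef_gram ℝ fun i => partialX V ψ i x))

theorem IsLocalParam.isUnit_metricBSqrt (hψ : IsLocalParam B V ψ) (hx : x ∈ V) :
    IsUnit (metricBSqrt V ψ x) := by
  have h : IsUnit (metricB V ψ x) :=
    (Matrix.posDef_gram_of_linearIndependent (hψ.linearIndependent_partialX hx)).isUnit
  rw [← metricBSqrt_mul_self] at h
  exact isUnit_of_mul_isUnit_left h

/-- The identity in `A` is rewritten as `R⁻¹ g_B R⁻¹`, with `R² = g_B`. -/
theorem IsLocalParam.deformationMatrix_eq (hψ : IsLocalParam B V ψ) (hx : x ∈ V) (ε : ℝ) :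
    deformationMatrix B V ε ψ e (x, n) = (metricBSqrt V ψ x)⁻¹ *
      (metricB V ψ x - ε • ∑ α, n α • shapeMatrix B V ψ e x α) * (metricBSqrt V ψ x)⁻¹ := by
  have h := (Matrix.isUnit_iff_isUnit_det _).1 (hψ.isUnit_metricBSqrt hx)
  rw [deformationMatrix, Matrix.mul_sub, Matrix.sub_mul, ← metricBSqrt_mul_self,
    ← Matrix.mul_assoc, Matrix.nonsing_inv_mul _ h, Matrix.one_mul, Matrix.mul_nonsing_inv _ h]
  simp [Finset.mul_sum, Finset.sum_mul]

end Adapted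

/-! ### The metric matrix and the gradient. -/

section Full

variable {d k : ℕ} {B : Set (Euc (d + k))} {V : Set (Euc d)} {ψ : Euc d → Euc (d + k)}
  {e : Fin k → Euc d → Euc (d + k)} {r : ℝ} {x : Euc d} {n : Euc k}

/-- The pushed horizontal fields lie in the span of the `∂ⱼψ` with mixed products `M = g_B - ε n^α
H_α`; symmetry of `M` turns `M g_B⁻¹ Mᵀ` into `R A² R`. -/
theorem IsNormalFrame.gram_horizontalField (he : IsNormalFrame B V ψ e)
    (hψ : IsLocalParam B V ψ) (hxn : (x, n) ∈ coordDomain k V r) {ε : ℝ} (hε : ε ≠ 0) :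
    Matrix.gram ℝ (fun i => pushMap (d + k) ε (horizontalField V r ε ψ e (x, n) i)) =
      metricBSqrt V ψ x * deformationMatrix B V ε ψ e (x, n) ^ 2 * metricBSqrt V ψ x := by
  have hsymm : (metricB V ψ x - ε • ∑ α, n α • shapeMatrix B V ψ e x α).transpose =
      metricB V ψ x - ε • ∑ α, n α • shapeMatrix B V ψ e x α := by
    ext i j
    simp [Matrix.sum_apply, he.shapeMatrix_apply hxn.1, hψ.partialX_comm hxn.1 i j, metricB,
      real_inner_comm]
  rw [gram_of_mem_span (hψ.linearIndependent_partialX hxn.1)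
    (he.pushMap_horizontalField_mem hψ hxn hε), hψ.deformationMatrix_eq hxn.1,
    mul_conj_inv_sq_mul (hψ.isUnit_metricBSqrt hxn.1), metricBSqrt_mul_self]
  have hN : (Matrix.of fun i j => inner ℝ (pushMap (d + k) ε
      (horizontalField V r ε ψ e (x, n) i)) (partialX V ψ j x)) =
      metricB V ψ x - ε • ∑ α, n α • shapeMatrix B V ψ e x α := by
    ext i j
    exact he.inner_pushMap_horizontalField hψ hxn hε i j
  rw [hN, hsymm]
  rfl

theorem IsNormalFrame.metricMatrix_eq (he : IsNormalFrame B V ψ e)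
    (hψ : IsLocalParam B V ψ) (hxn : (x, n) ∈ coordDomain k V r) {ε : ℝ} (hε : ε ≠ 0) :
    metricMatrix V r ε ψ e (x, n) = Matrix.fromBlocks
      (metricBSqrt V ψ x * deformationMatrix B V ε ψ e (x, n) ^ 2 * metricBSqrt V ψ x) 0
      0 (ε ^ 2 • (1 : Matrix (Fin k) (Fin k) ℝ)) := by
  rw [← he.gram_horizontalField hψ hxn hε]
  ext (i | α) (j | β)
  · simp [metricMatrix, scaledMetric_eq, adaptedFrame, Matrix.gram_apply]
  · simp [metricMatrix, scaledMetric_eq, adaptedFrame,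
      he.inner_pushMap_horizontalField_fibreField hψ hxn hε]
  · simp only [metricMatrix, scaledMetric_eq, adaptedFrame, Matrix.of_apply, Sum.elim_inr,
      Sum.elim_inl, Matrix.fromBlocks_apply₂₁, Matrix.zero_apply]
    rw [real_inner_comm]
    exact he.inner_pushMap_horizontalField_fibreField hψ hxn hε j α
  · simpa only [metricMatrix, scaledMetric_eq, adaptedFrame, Matrix.of_apply, Sum.elim_inr,
      Matrix.fromBlocks_apply₂₂] using he.inner_pushMap_fibreField hψ hxn ε α β

end Full

end TubeMetric

theorem mainTheorem11 {d k : ℕ} (B : Set (Euc (d + k))) (hBc : IsCompact B)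
    (hB : IsSmoothSubmanifold d B) (r : ℝ) (hr : IsTubularRadius B r)
    (ε : ℝ) (hε0 : 0 < ε) (hε1 : ε < 1)
    (V : Set (Euc d)) (ψ : Euc d → Euc (d + k)) (hψ : IsLocalParam B V ψ)
    (e : Fin k → Euc d → Euc (d + k)) (he : IsNormalFrame B V ψ e)
    (x : Euc d) (n : Euc k) (hxn : (x, n) ∈ coordDomain k V r) :
    -- the adapted frame is a basis of the tangent space of the normal bundle
    LinearIndependent ℝ (adaptedFrame V r ε ψ e (x, n)) ∧
    Submodule.span ℝ (Set.range (adaptedFrame V r ε ψ e (x, n))) =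
      tangentSpaceOf (normalBundle B r) (bundleParam ψ e (x, n)) ∧
    -- the matrices that are inverted below are invertible
    IsUnit (metricBSqrt V ψ x) ∧ IsUnit (deformationMatrix B V ε ψ e (x, n)) ∧
    -- the metric in the adapted frame
    metricMatrix V r ε ψ e (x, n) =
      Matrix.fromBlocks
        (metricBSqrt V ψ x * deformationMatrix B V ε ψ e (x, n) ^ 2 * metricBSqrt V ψ x) 0
        0 (ε ^ 2 • (1 : Matrix (Fin k) (Fin k) ℝ)) ∧
    -- the Riemannian gradient in the adapted frame
    ∀ φ : Euc (d + k) × Euc (d + k) → ℝ, ContDiffOn ℝ ∞ φ (normalBundle B r) →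
      ∀ w : Euc (d + k) × Euc (d + k),
        IsGradientAt B r ε φ (bundleParam ψ e (x, n)) w ↔
          w = ∑ i, ((metricBSqrt V ψ x)⁻¹ * (deformationMatrix B V ε ψ e (x, n) ^ 2)⁻¹ *
                  (metricBSqrt V ψ x)⁻¹).mulVec
                (gradX V r ψ e φ (x, n) -
                  (∑ β, n β • connectionMatrix B V ψ e x β).mulVec (gradN V r ψ e φ (x, n))) i •
                horizontalField V r ε ψ e (x, n) i +
              ∑ α, ((ε ^ 2)⁻¹ * gradN V r ψ e φ (x, n) α) • fibreField V r ψ e (x, n) α := by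
  have hε : ε ≠ 0 := hε0.ne'
  have hframe := he.adaptedFrame_eq hψ hxn hε
  have hbinj := he.bundleDeriv_injective hψ (q := (x, n)) hxn.1
  have hli : LinearIndependent ℝ (adaptedFrame V r ε ψ e (x, n)) := by
    rw [hframe]
    exact (linearIndependent_modelFrame _).map_injOn (bundleDeriv V ψ e (x, n)).toLinearMap
      hbinj.injOn
  have hspan : Submodule.span ℝ (Set.range (adaptedFrame V r ε ψ e (x, n))) =
      tangentSpaceOf (normalBundle B r) (bundleParam ψ e (x, n)) := by
    rw [he.tangentSpaceOf_normalBundle hψ hxn, hframe, Set.range_comp, LinearMap.range_eq_map,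
      ← span_modelFrame (∑ β, n β • connectionMatrix B V ψ e x β), Submodule.map_span]
    rfl
  have hpush : LinearIndependent ℝ
      ((pushMap (d + k) ε).toLinearMap ∘ adaptedFrame V r ε ψ e (x, n)) := by
    rw [hframe]
    exact (linearIndependent_modelFrame _).map_injOn
      ((pushMap (d + k) ε).comp (bundleDeriv V ψ e (x, n))).toLinearMap
      (hr.injective_pushMap_comp he hψ hε0 hε1 hxn).injOn
  have hR := hψ.isUnit_metricBSqrt hxn.1
  have hgram := he.gram_horizontalField hψ hxn hε
  have hA : IsUnit (deformationMatrix B V ε ψ e (x, n)) := by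
    -- The pushed horizontal fields are independent, so their Gram matrix `R A² R` is positive
    -- definite; taking determinants forces `det A` to be a unit.
    have h : IsUnit (Matrix.gram ℝ
        fun i => pushMap (d + k) ε (horizontalField V r ε ψ e (x, n) i)) :=
      (Matrix.posDef_gram_of_linearIndependent (hpush.comp Sum.inl Sum.inl_injective)).isUnit
    rw [hgram] at h
    rw [Matrix.isUnit_iff_isUnit_det] at h ⊢
    rw [Matrix.det_mul, Matrix.det_mul, Matrix.det_pow] at h
    exact (isUnit_pow_iff two_ne_zero).1
      (isUnit_of_mul_isUnit_right (isUnit_of_mul_isUnit_left h))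
  have hmetric := he.metricMatrix_eq hψ hxn hε
  refine ⟨hli, hspan, hR, hA, hmetric, fun φ hφ w => ?_⟩
  set η := fderivWithin ℝ φ (normalBundle B r) (bundleParam ψ e (x, n)) with hη
  have hchain : fderivWithin ℝ (φ ∘ bundleParam ψ e) (coordDomain k V r) (x, n) =
      η.comp (bundleDeriv V ψ e (x, n)) :=
    ((hφ.differentiableOn (by simp) _ (he.mapsTo_bundleParam hψ r hxn)).hasFDerivWithinAt.comp
      (x, n) (he.hasFDerivWithinAt_bundleParam hψ hxn)
      (he.mapsTo_bundleParam hψ r)).fderivWithin (hψ.uniqueDiffOn_coordDomain k r _ hxn)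
  have hη2 : ∀ α, η (fibreField V r ψ e (x, n) α) = gradN V r ψ e φ (x, n) α := fun α => by
    rw [gradN, hchain, fibreField, he.fderivWithin_bundleParam hψ hxn]
    rfl
  have hη1 : ∀ i, η (horizontalField V r ε ψ e (x, n) i) = (gradX V r ψ e φ (x, n) -
      (∑ β, n β • connectionMatrix B V ψ e x β).mulVec (gradN V r ψ e φ (x, n))) i := fun i => by
    rw [he.horizontalField_eq_sub hψ hxn hε, map_sub, map_sum, Pi.sub_apply]
    congr 1
    · rw [gradX, hchain, coordField, he.fderivWithin_bundleParam hψ hxn]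
      rfl
    · simp only [map_smul, hη2, Matrix.mulVec, dotProduct, smul_eq_mul]
  -- The claimed components solve the normal equations: the block matrix of `g_ε` sends them to the
  -- values of `dφ` on the adapted frame.
  have hc : (Matrix.gram ℝ
      ((pushMap (d + k) ε).toLinearMap ∘ adaptedFrame V r ε ψ e (x, n))).mulVec
      (Sum.elim (((metricBSqrt V ψ x)⁻¹ * (deformationMatrix B V ε ψ e (x, n) ^ 2)⁻¹ *
        (metricBSqrt V ψ x)⁻¹).mulVec (gradX V r ψ e φ (x, n) -
          (∑ β, n β • connectionMatrix B V ψ e x β).mulVec (gradN V r ψ e φ (x, n))))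
        fun α => (ε ^ 2)⁻¹ * gradN V r ψ e φ (x, n) α) =
      η.toLinearMap ∘ adaptedFrame V r ε ψ e (x, n) := by
    have hG : Matrix.gram ℝ ((pushMap (d + k) ε).toLinearMap ∘ adaptedFrame V r ε ψ e (x, n)) =
        metricMatrix V r ε ψ e (x, n) := by
      ext a b
      simp [Matrix.gram_apply, metricMatrix, scaledMetric_eq]
    rw [hG, hmetric, Matrix.fromBlocks_mulVec]
    have hRd := (Matrix.isUnit_iff_isUnit_det _).1 hR
    have hAd := (Matrix.isUnit_iff_isUnit_det _).1 (hA.pow 2)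
    funext a
    rcases a with i | α
    · simp only [Sum.elim_comp_inl, Sum.elim_comp_inr, Matrix.zero_mulVec, add_zero,
        Sum.elim_inl, Matrix.mulVec_mulVec, Function.comp]
      refine Eq.trans ?_ (hη1 i).symm
      simp only [Matrix.mul_assoc, Matrix.mul_nonsing_inv_cancel_left _ _ hRd,
        Matrix.mul_nonsing_inv_cancel_left _ _ hAd, Matrix.mul_nonsing_inv _ hRd,
        Matrix.one_mulVec]
    · simp only [Sum.elim_comp_inl, Sum.elim_comp_inr, Matrix.zero_mulVec, zero_add,
        Sum.elim_inr, Matrix.smul_mulVec, Matrix.one_mulVec, Function.comp]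
      refine Eq.trans ?_ (hη2 α).symm
      simp [hε]
  have hfinal := isGradient_iff_eq_sum hpush hc w
  rw [Fintype.sum_sum_type, hspan] at hfinal
  simp only [IsGradientAt, scaledMetric_eq]
  exact hfinal
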